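/- Let $n\ge 0$ be an integer and $p\in[0,1]$. Let $G\sim\vec G(n,p)$ be an Erdős–Rényi random directed graph: $G$ has $n$ nodes and no loops, and each of the $n(n-1)$ ordered pairs of distinct nodes is a directed edge with probability $p$, independently of the others (both edges between two nodes may be present). The directed flag complex $\mathrm{dFl}(G)$ has as $k$-simplices the $(k+1)$-tuples $(v_0,\dots,v_k)$ of distinct nodes such that $(v_i,v_j)$ is an edge whenever $i<j$. Its chain complex over $\mathbb Z$ is freely generated by these simplices, is augmented by $\mathbb Z$ in degree $-1$, and has boundary $\partial(v_0,\dots,v_k)=\sum_{i=0}^{k}(-1)^i(v_0,\dots,\widehat{v_i},\dots,v_k)$. Let $\beta_1(\mathrm{dFl}(G))$ denote the rank of the first homology group $\ker\partial_1/\operatorname{im}\partial_2$. Then $$ \mathbb P\bigl(\beta_1(\mathrm{dFl}(G))>0\bigr)\;\le\; \binom n4\,4!\,\sum_{m=0}^{3}p^3(1-p)^{c_m}\Bigl(1-\sum_{l=0}^{8}q_{m,l}\,p^l(1-p)^{8-l}\Bigr)^{n-4} +\binom n2p^2\bigl[1-p^2\bigr]^{2n-4}+2\binom n3p^3\bigl[1-p^3\bigr]^{2n-6},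 $$ where $\mathbf c=(c_0,c_1,c_2,c_3)=(2,3,3,4)$ and $$ Q=(q_{m,l})_{0\le m\le 3,\;0\le l\le 8}=\begin{pmatrix} 0&0&0&0&5&16&19&8&1\\ 0&0&0&0&7&20&20&8&1\\ 0&0&0&0&7&20&20&8&1\\ 0&0&0&0&8&22&21&8&1 \end{pmatrix}. $$ Here $0^0=1$, and a summand whose binomial coefficient is zero is read as zero. -/

import Mathlib

open MeasureTheory ProbabilityTheory

namespace Digraph

section DirectedFlagComplex

variable {V : Type*} (G : Digraph V)

/-- A tuple `(v 0, …, v (m - 1))` of distinct vertices is a directed `m`-clique of `G` if there is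
an edge from `v i` to `v j` whenever `i < j`. -/
def IsDirectedClique {m : ℕ} (v : Fin m → V) : Prop :=
  Function.Injective v ∧ ∀ i j : Fin m, i < j → G.Adj (v i) (v j)

theorem IsDirectedClique.comp_succAbove {G : Digraph V} {m : ℕ} {v : Fin (m + 1) → V}
    (hv : G.IsDirectedClique v) (i : Fin (m + 1)) : G.IsDirectedClique (v ∘ i.succAbove) :=
  ⟨hv.1.comp Fin.succAbove_right_injective,
    fun _ _ hjk => hv.2 _ _ (Fin.strictMono_succAbove i hjk)⟩

/-- The directed `m`-cliques of `G`, i.e. the `(m - 1)`-simplices of the directed flag complex. -/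
abbrev DirectedClique (m : ℕ) : Type _ := {v : Fin m → V // G.IsDirectedClique v}

/-- The clique obtained by removing the `i`-th vertex. -/
def DirectedClique.face {G : Digraph V} {m : ℕ} (s : G.DirectedClique (m + 1))
    (i : Fin (m + 1)) : G.DirectedClique m :=
  ⟨s.1 ∘ i.succAbove, s.2.comp_succAbove i⟩

/-- The free abelian group on the directed `m`-cliques. This is the chain group in degree `m - 1` of
the augmented directed flag complex: for `m = 0` there is exactly one (empty) clique, so it
is a copy of `ℤ` in degree `-1`. -/
abbrev FlagChain (m : ℕ) : Type _ := G.DirectedClique m →₀ ℤ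

/-- The boundary map, which sends a directed `(m + 1)`-clique (degree `m`) to the alternating sum
of its faces (degree `m - 1`). For `m = 0` it sums the coefficients. -/
noncomputable def flagBoundary (m : ℕ) : G.FlagChain (m + 1) →ₗ[ℤ] G.FlagChain m :=
  Finsupp.linearCombination ℤ fun s : G.DirectedClique (m + 1) =>
    ∑ i : Fin (m + 1), (-1 : ℤ) ^ (i : ℕ) • Finsupp.single (s.face i) (1 : ℤ)

theorem flagBoundary_single {m : ℕ} (s : G.DirectedClique (m + 1)) :
    G.flagBoundary m (Finsupp.single s 1) =
      ∑ i : Fin (m + 1), (-1 : ℤ) ^ (i : ℕ) • Finsupp.single (s.face i) (1 : ℤ) := by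
  simp [flagBoundary]

theorem flagBoundary_comp_flagBoundary (m : ℕ) :
    G.flagBoundary m ∘ₗ G.flagBoundary (m + 1) = 0 := by
  refine Finsupp.lhom_ext' fun s => LinearMap.ext_ring ?_
  simp only [LinearMap.comp_apply, Finsupp.lsingle_apply, flagBoundary_single, map_sum, map_smul,
    Finset.smul_sum, smul_smul, LinearMap.zero_apply]
  rw [← Finset.sum_product' Finset.univ Finset.univ
    (fun (i : Fin (m + 2)) (j : Fin (m + 1)) => ((-1 : ℤ) ^ (i : ℕ) * (-1) ^ (j : ℕ)) •
      Finsupp.single ((s.face i).face j) (1 : ℤ))]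
  refine Finset.sum_involution (fun ij _ => (ij.1.succAbove ij.2, ij.2.predAbove ij.1)) ?_ ?_ ?_ ?_
  · rintro ⟨i, j⟩ -
    have hface : (s.face (i.succAbove j)).face (j.predAbove i) = (s.face i).face j := by
      apply Subtype.ext
      funext k
      exact congrArg s.1 (Fin.succAbove_succAbove_succAbove_predAbove i j k)
    have hsign : (-1 : ℤ) ^ (i : ℕ) * (-1) ^ (j : ℕ)
        + (-1) ^ (i.succAbove j : ℕ) * (-1) ^ (j.predAbove i : ℕ) = 0 := by
      rcases lt_or_ge j.castSucc i with h | h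
      · have h0 : i ≠ 0 := Fin.ne_zero_of_lt h
        obtain ⟨i, rfl⟩ := Fin.exists_succ_eq.2 h0
        rw [Fin.succAbove_of_castSucc_lt _ _ h, Fin.predAbove_of_castSucc_lt _ _ h]
        simp [pow_succ]
        ring
      · rw [Fin.succAbove_of_le_castSucc _ _ h, Fin.predAbove_of_le_castSucc _ _ h]
        simp [pow_succ]
        ring
    simp only [hface, ← add_smul, hsign, zero_smul]
  · rintro ⟨i, j⟩ - - h
    exact Fin.succAbove_ne i j (congrArg Prod.fst h)
  · simp
  · rintro ⟨i, j⟩ -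
    ext
    · exact congrArg Fin.val (Fin.succAbove_succAbove_predAbove i j)
    · simp only [Fin.succAbove, Fin.predAbove, Fin.lt_def, Fin.val_castSucc, apply_dite Fin.val,
        Fin.val_pred, Fin.coe_castPred, dite_eq_ite, apply_ite Fin.val, Fin.val_succ]
      split_ifs <;> lia

/-- The `k`-cycles of the directed flag complex, chains in degree `k` being spanned by the directed
`(k + 1)`-cliques. -/
noncomputable abbrev FlagCycles (k : ℕ) : Submodule ℤ (G.FlagChain (k + 1)) :=
  LinearMap.ker (G.flagBoundary k)

/-- The boundary map from the chains in degree `k + 1` to the cycles in degree `k`. -/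
noncomputable def flagBoundaryToCycles (k : ℕ) :
    G.FlagChain (k + 2) →ₗ[ℤ] G.FlagCycles k :=
  (G.flagBoundary (k + 1)).codRestrict _ fun x =>
    LinearMap.congr_fun (G.flagBoundary_comp_flagBoundary k) x

/-- The `k`-th homology group `ker ∂ₖ / im ∂ₖ₊₁` of the directed flag complex. -/
abbrev FlagHomology (k : ℕ) : Type _ :=
  G.FlagCycles k ⧸ LinearMap.range (G.flagBoundaryToCycles k)

/-- The `k`-th Betti number of the directed flag complex with coefficients in `ℤ`: the rank of the
`k`-th homology group. -/
noncomputable def flagBetti (k : ℕ) : ℕ := Module.finrank ℤ (G.FlagHomology k)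

end DirectedFlagComplex

section RandomDigraph

variable {V : Type*}

/-- The product sigma-algebra on digraphs, generated by the events that a given edge is present. -/
instance : MeasurableSpace (Digraph V) := .comap Digraph.Adj inferInstance

/-- The digraph with a given edge set. -/
def ofEdgeSet (E : Set (V × V)) : Digraph V := ⟨fun a b => (a, b) ∈ E⟩

theorem measurable_ofEdgeSet : Measurable (ofEdgeSet : Set (V × V) → Digraph V) := by
  refine measurable_comap_iff.2 ?_
  refine measurable_pi_lambda _ fun a => measurable_pi_lambda _ fun b => ?_
  exact measurable_set_mem (a, b)

/-- The Erdős–Rényi random directed graph model on the nodes `Fin n`: each ordered pair of distinct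
nodes is an edge with probability `p`, independently of all the others, and there are no loops. -/
noncomputable def erdosRenyi (n : ℕ) (p : unitInterval) : Measure (Digraph (Fin n)) :=
  (setBernoulli {e : Fin n × Fin n | e.1 ≠ e.2} p).map ofEdgeSet

instance (n : ℕ) (p : unitInterval) : IsProbabilityMeasure (erdosRenyi n p) :=
  Measure.isProbabilityMeasure_map measurable_ofEdgeSet.aemeasurable

end RandomDigraph

end Digraph

/-- The vector `c` of numbers of possible shortcut edges, one entry for each of the four
orientation classes of undirected paths of length 3. -/
def shortcutCount : Fin 4 → ℕ := ![2, 3, 3, 4]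

/-- The matrix `Q`: the entry `(m, l)` is the number of sets of `l` linking edges that make a fifth
vertex a directed centre of a path of length 3 in class `m`. -/
def centreCount : Matrix (Fin 4) (Fin 9) ℕ :=
  !![0, 0, 0, 0, 5, 16, 19, 8, 1;
     0, 0, 0, 0, 7, 20, 20, 8, 1;
     0, 0, 0, 0, 7, 20, 20, 8, 1;
     0, 0, 0, 0, 8, 22, 21, 8, 1]

/-! The obstructions to vanishing are local. Suppose every double edge and every directed 3-cycle
has a common in-neighbour or out-neighbour. Then, modulo boundaries, an edge may be traversed in
both directions and every triangle of pairwise linked vertices closes up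
(`DoubleEdgesFilled.stepClass_symm`, `stepClass_triangle`), so orientations cease to matter. Suppose
moreover that every undirected path of length 3 has a shortcut or a vertex linked to all four of its
vertices. A nonzero 1-cycle flows along some walk a, b, c, d. Replacing two steps by at most one, or
three steps by two through the centre, yields a homologous cycle of smaller ℓ¹-norm, and descent
gives vanishing homology (`flagBetti_one_eq_zero`).

Hence a positive Betti number forces an unshortened path, an unfilled double edge or an unfilled
3-cycle. Distinct outer vertices use disjoint sets of edges, so these configurations have product
probabilities (`real_inter_biInter`), and a union bound gives the three summands. The centres used
here need only be linked to the path. They are more frequent than the directed centres counted by Q,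
so the resulting bound is at least as strong as the stated one (`sum_centreCount_le`). -/

namespace Digraph

/-! ### Edge classes modulo boundaries -/

section OneCycles

variable {V : Type*} {G : Digraph V}

/-- Two distinct vertices joined by an edge in at least one direction. -/
def Linked (G : Digraph V) (a b : V) : Prop := a ≠ b ∧ (G.Adj a b ∨ G.Adj b a)

theorem Linked.symm {a b : V} (h : G.Linked a b) : G.Linked b a := ⟨h.1.symm, h.2.symm⟩

theorem isDirectedClique_pair {a b : V} (hab : a ≠ b) (h : G.Adj a b) :
    G.IsDirectedClique ![a, b] := by
  refine ⟨?_, ?_⟩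
  · intro i j hij
    fin_cases i <;> fin_cases j <;> simp_all [eq_comm]
  · intro i j hij
    fin_cases i <;> fin_cases j <;> simp_all

theorem isDirectedClique_triple {a b c : V} (hab : a ≠ b) (hac : a ≠ c) (hbc : b ≠ c)
    (h₁ : G.Adj a b) (h₂ : G.Adj a c) (h₃ : G.Adj b c) : G.IsDirectedClique ![a, b, c] := by
  refine ⟨?_, ?_⟩
  · intro i j hij
    fin_cases i <;> fin_cases j <;> simp_all [eq_comm]
  · intro i j hij
    fin_cases i <;> fin_cases j <;> simp_all

theorem DirectedClique.ext_two {u v : G.DirectedClique 2} (h₀ : u.1 0 = v.1 0)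
    (h₁ : u.1 1 = v.1 1) : u = v := by
  apply Subtype.ext
  funext i
  fin_cases i <;> assumption

theorem DirectedClique.ne (u : G.DirectedClique 2) : u.1 0 ≠ u.1 1 := fun h => by
  simpa using u.2.1 h

theorem DirectedClique.adj (u : G.DirectedClique 2) : G.Adj (u.1 0) (u.1 1) :=
  u.2.2 0 1 (by simp)

/-- The one-dimensional chains modulo boundaries. -/
abbrev ChainClass (G : Digraph V) : Type _ :=
  G.FlagChain 2 ⧸ LinearMap.range (G.flagBoundary 2)

open Classical in
/-- The class of the step from `a` to `b`: it uses the edge from `a` to `b` if there is one, and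
otherwise runs backwards through the edge from `b` to `a`. -/
noncomputable def stepClass (G : Digraph V) (a b : V) : G.ChainClass :=
  if h : a ≠ b ∧ G.Adj a b then
    Submodule.Quotient.mk (Finsupp.single ⟨_, isDirectedClique_pair h.1 h.2⟩ 1)
  else if h : b ≠ a ∧ G.Adj b a then
    -Submodule.Quotient.mk (Finsupp.single ⟨_, isDirectedClique_pair h.1 h.2⟩ 1)
  else 0

theorem mk_single_eq_stepClass (u : G.DirectedClique 2) :
    (Submodule.Quotient.mk (Finsupp.single u 1) : G.ChainClass) =
      G.stepClass (u.1 0) (u.1 1) := by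
  rw [stepClass, dif_pos ⟨u.ne, u.adj⟩]
  congr 2
  exact DirectedClique.ext_two rfl rfl

/-- The boundary of the simplex (a, b, c) is bc − ac + ab. -/
theorem stepClass_add_stepClass {a b c : V} (hab : a ≠ b) (hac : a ≠ c) (hbc : b ≠ c)
    (h₁ : G.Adj a b) (h₂ : G.Adj a c) (h₃ : G.Adj b c) :
    G.stepClass a b + G.stepClass b c = G.stepClass a c := by
  have h : (Submodule.Quotient.mk (G.flagBoundary 2
      (Finsupp.single ⟨_, isDirectedClique_triple hab hac hbc h₁ h₂ h₃⟩ 1)) : G.ChainClass) = 0 :=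
    (Submodule.Quotient.mk_eq_zero _).2 ⟨_, rfl⟩
  rw [flagBoundary_single, Fin.sum_univ_three] at h
  simp only [Submodule.Quotient.mk_add, Submodule.Quotient.mk_smul, mk_single_eq_stepClass] at h
  change ((-1 : ℤ) ^ 0) • G.stepClass b c + ((-1 : ℤ) ^ 1) • G.stepClass a c +
    ((-1 : ℤ) ^ 2) • G.stepClass a b = 0 at h
  simp only [pow_zero, one_smul, pow_one, neg_smul, even_two, Even.neg_pow, one_pow] at h
  rw [← sub_eq_zero, ← h]
  abel

/-- Every pair of opposite edges has a common in-neighbour or a common out-neighbour. -/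
def DoubleEdgesFilled (G : Digraph V) : Prop :=
  ∀ a b, a ≠ b → G.Adj a b → G.Adj b a →
    ∃ w, w ≠ a ∧ w ≠ b ∧ ((G.Adj w a ∧ G.Adj w b) ∨ (G.Adj a w ∧ G.Adj b w))

/-- Every directed 3-cycle has a common in-neighbour or a common out-neighbour. -/
def CyclicTrianglesFilled (G : Digraph V) : Prop :=
  ∀ a b c, a ≠ b → a ≠ c → b ≠ c → G.Adj a b → G.Adj b c → G.Adj c a →
    ∃ w, w ≠ a ∧ w ≠ b ∧ w ≠ c ∧
      ((G.Adj w a ∧ G.Adj w b ∧ G.Adj w c) ∨ (G.Adj a w ∧ G.Adj b w ∧ G.Adj c w))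

/-- Every undirected path of length 3 has a shortcut or a vertex linked to all of its vertices. -/
def PathsShortened (G : Digraph V) : Prop :=
  ∀ v : Fin 4 → V, Function.Injective v →
    G.Linked (v 0) (v 1) → G.Linked (v 1) (v 2) → G.Linked (v 2) (v 3) →
    G.Linked (v 0) (v 2) ∨ G.Linked (v 1) (v 3) ∨ ∃ w, ∀ i, G.Linked w (v i)

/-- The two triangles on w with ab and with ba share their other two edges, and these cancel. -/
theorem DoubleEdgesFilled.stepClass_add (hB : G.DoubleEdgesFilled) {a b : V} (hab : a ≠ b)
    (h₁ : G.Adj a b) (h₂ : G.Adj b a) : G.stepClass a b + G.stepClass b a = 0 := by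
  obtain ⟨w, hwa, hwb, ⟨ha, hb⟩ | ⟨ha, hb⟩⟩ := hB a b hab h₁ h₂
  · have e₁ := stepClass_add_stepClass hwa hwb hab ha hb h₁
    have e₂ := stepClass_add_stepClass hwb hwa hab.symm hb ha h₂
    rw [← e₁, add_assoc] at e₂
    exact add_eq_left.1 e₂
  · have e₁ := stepClass_add_stepClass hab hwa.symm hwb.symm h₁ ha hb
    have e₂ := stepClass_add_stepClass hab.symm hwb.symm hwa.symm h₂ hb ha
    rw [← e₂, ← add_assoc] at e₁
    exact add_eq_right.1 e₁

/-- Filling matters only when both edges exist; with a single edge this is built into `stepClass`.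
-/
theorem DoubleEdgesFilled.stepClass_symm (hB : G.DoubleEdgesFilled) {a b : V}
    (h : G.Linked a b) : G.stepClass b a = -G.stepClass a b := by
  obtain ⟨hab, h⟩ := h
  by_cases h₁ : G.Adj a b <;> by_cases h₂ : G.Adj b a
  · rw [eq_neg_iff_add_eq_zero, add_comm]
    exact hB.stepClass_add hab h₁ h₂
  · simp [stepClass, hab, hab.symm, h₁, h₂]
  · simp [stepClass, hab, hab.symm, h₁, h₂]
  · tauto

/-- A directed 3-cycle is no simplex, but its cone with apex w consists of three simplices whose
relations telescope. -/
theorem stepClass_cyclic (hC : G.CyclicTrianglesFilled) {a b c : V} (hab : a ≠ b) (hac : a ≠ c)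
    (hbc : b ≠ c) (h₁ : G.Adj a b) (h₂ : G.Adj b c) (h₃ : G.Adj c a) :
    G.stepClass a b + G.stepClass b c + G.stepClass c a = 0 := by
  obtain ⟨w, hwa, hwb, hwc, ⟨ha, hb, hc⟩ | ⟨ha, hb, hc⟩⟩ := hC a b c hab hac hbc h₁ h₂ h₃
  · rw [eq_sub_of_add_eq' (stepClass_add_stepClass hwa hwb hab ha hb h₁),
      eq_sub_of_add_eq' (stepClass_add_stepClass hwb hwc hbc hb hc h₂),
      eq_sub_of_add_eq' (stepClass_add_stepClass hwc hwa hac.symm hc ha h₃)]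
    abel
  · rw [eq_sub_of_add_eq (stepClass_add_stepClass hab hwa.symm hwb.symm h₁ ha hb),
      eq_sub_of_add_eq (stepClass_add_stepClass hbc hwb.symm hwc.symm h₂ hb hc),
      eq_sub_of_add_eq (stepClass_add_stepClass hac.symm hwc.symm hwa.symm h₃ hc ha)]
    abel

/-- Of the eight orientations, six are transitive and bound a simplex; the other two are cyclic and
need `stepClass_cyclic`. -/
theorem stepClass_triangle (hB : G.DoubleEdgesFilled) (hC : G.CyclicTrianglesFilled) {a b c : V}
    (hab : G.Linked a b) (hbc : G.Linked b c) (hac : G.Linked a c) :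
    G.stepClass a b + G.stepClass b c = G.stepClass a c := by
  have sab := hB.stepClass_symm hab
  have sbc := hB.stepClass_symm hbc
  have sac := hB.stepClass_symm hac
  obtain ⟨nab, hab⟩ := hab
  obtain ⟨nbc, hbc⟩ := hbc
  obtain ⟨nac, hac⟩ := hac
  rcases hab with hab | hab <;> rcases hbc with hbc | hbc <;> rcases hac with hac | hac
  · exact stepClass_add_stepClass nab nac nbc hab hac hbc
  · have := stepClass_cyclic hC nab nac nbc hab hbc hac
    rw [sac] at this
    rwa [← sub_eq_zero, sub_eq_add_neg]
  · have := stepClass_add_stepClass nac nab nbc.symm hac hab hbc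
    rw [sbc] at this
    rw [← this]; abel
  · have := stepClass_add_stepClass nac.symm nbc.symm nab hac hbc hab
    rw [sbc, sac] at this
    rw [← sub_eq_zero, ← sub_eq_zero.2 this]; abel
  · have := stepClass_add_stepClass nab.symm nbc nac hab hbc hac
    rw [sab] at this
    rw [← this]; abel
  · have := stepClass_add_stepClass nbc nab.symm nac.symm hbc hab hac
    rw [sab, sac] at this
    rw [← sub_eq_zero, ← neg_eq_zero, ← sub_eq_zero.2 this.symm]; abel
  · have := stepClass_cyclic hC nac nab nbc.symm hac hbc hab
    rw [sab, sbc] at this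
    rw [← sub_eq_zero, ← neg_eq_zero, ← this]; abel
  · have := stepClass_add_stepClass nbc.symm nac.symm nab.symm hbc hac hab
    rw [sab, sbc, sac] at this
    rw [← sub_eq_zero, ← neg_eq_zero, ← sub_eq_zero.2 this]; abel

/-! ### Descent on the ℓ¹-norm of a cycle -/

/-- The sum of the absolute values of the coefficients of an integral chain. -/
def chainNorm {α : Type*} (z : α →₀ ℤ) : ℕ := z.sum fun _ k => k.natAbs

theorem chainNorm_eq_sum {α : Type*} (z : α →₀ ℤ) {s : Finset α} (h : z.support ⊆ s) :
    chainNorm z = ∑ u ∈ s, (z u).natAbs :=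
  Finsupp.sum_of_support_subset z h _ (by simp)

theorem chainNorm_add_le {α : Type*} (y z : α →₀ ℤ) :
    chainNorm (y + z) ≤ chainNorm y + chainNorm z := by
  classical
  rw [chainNorm_eq_sum (y + z) Finsupp.support_add,
    chainNorm_eq_sum y Finset.subset_union_left, chainNorm_eq_sum z Finset.subset_union_right,
    ← Finset.sum_add_distrib]
  exact Finset.sum_le_sum fun u _ => Int.natAbs_add_le _ _

theorem chainNorm_add_single {α : Type*} (z : α →₀ ℤ) (u : α) (k : ℤ)
    (h : (z u + k).natAbs + 1 = (z u).natAbs) :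
    chainNorm (z + Finsupp.single u k) + 1 = chainNorm z := by
  classical
  have hu : u ∈ z.support := by
    rw [Finsupp.mem_support_iff]
    intro h0
    simp [h0] at h
  have hs : (z + Finsupp.single u k).support ⊆ z.support := by
    refine Finsupp.support_add.trans (Finset.union_subset subset_rfl ?_)
    exact Finsupp.support_single_subset.trans (by simpa using hu)
  rw [chainNorm_eq_sum _ hs, chainNorm_eq_sum z subset_rfl, ← Finset.add_sum_erase _ _ hu,
    ← Finset.add_sum_erase _ _ hu, Finsupp.add_apply, Finsupp.single_eq_same, ← h]
  have : ∑ x ∈ z.support.erase u, ((z + Finsupp.single u k) x).natAbs =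
      ∑ x ∈ z.support.erase u, (z x).natAbs := by
    refine Finset.sum_congr rfl fun x hx => ?_
    rw [Finsupp.add_apply, Finsupp.single_eq_of_ne (Finset.ne_of_mem_erase hx), add_zero]
  omega

/-- The chain `z` runs from `a` to `b` through some edge between these vertices. -/
def Flows (z : G.FlagChain 2) (a b : V) : Prop :=
  ∃ u : G.DirectedClique 2, (u.1 0 = a ∧ u.1 1 = b ∧ 0 < z u) ∨ (u.1 0 = b ∧ u.1 1 = a ∧ z u < 0)

theorem Flows.linked {z : G.FlagChain 2} {a b : V} (h : Flows z a b) : G.Linked a b := by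
  obtain ⟨u, ⟨rfl, rfl, -⟩ | ⟨rfl, rfl, -⟩⟩ := h
  · exact ⟨u.ne, Or.inl u.adj⟩
  · exact ⟨u.ne.symm, Or.inr u.adj⟩

/-- Only one coefficient moves, one unit towards zero. The last clause allows the successive steps
of a walk to be removed in turn. -/
theorem Flows.exists_sub (hB : G.DoubleEdgesFilled) {z : G.FlagChain 2} {a b : V}
    (h : Flows z a b) : ∃ z' : G.FlagChain 2, chainNorm z' + 1 = chainNorm z ∧
      (Submodule.Quotient.mk z' : G.ChainClass) = Submodule.Quotient.mk z - G.stepClass a b ∧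
      ∀ c d, (c ≠ a ∨ d ≠ b) → Flows z c d → Flows z' c d := by
  have hl := h.linked
  obtain ⟨u, ⟨h0, h1, hu⟩ | ⟨h0, h1, hu⟩⟩ := h
  · refine ⟨z + Finsupp.single u (-1), chainNorm_add_single _ _ _ (by omega), ?_, ?_⟩
    · rw [Finsupp.single_neg, ← sub_eq_add_neg, Submodule.Quotient.mk_sub,
        mk_single_eq_stepClass, h0, h1]
    · rintro c d hcd ⟨v, hv⟩
      have hvu : v ≠ u := by rintro rfl; grind
      refine ⟨v, ?_⟩
      rwa [Finsupp.add_apply, Finsupp.single_eq_of_ne hvu, add_zero]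
  · refine ⟨z + Finsupp.single u 1, chainNorm_add_single _ _ _ (by omega), ?_, ?_⟩
    · rw [Submodule.Quotient.mk_add, mk_single_eq_stepClass, h0, h1, hB.stepClass_symm hl,
        sub_eq_add_neg]
    · rintro c d hcd ⟨v, hv⟩
      have hvu : v ≠ u := by rintro rfl; grind
      refine ⟨v, ?_⟩
      rwa [Finsupp.add_apply, Finsupp.single_eq_of_ne hvu, add_zero]

theorem Linked.exists_add (hB : G.DoubleEdgesFilled) {a b : V} (h : G.Linked a b)
    (z : G.FlagChain 2) : ∃ z' : G.FlagChain 2, chainNorm z' ≤ chainNorm z + 1 ∧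
      (Submodule.Quotient.mk z' : G.ChainClass) = Submodule.Quotient.mk z + G.stepClass a b := by
  rcases h.2 with h' | h'
  · refine ⟨z + Finsupp.single ⟨_, isDirectedClique_pair h.1 h'⟩ 1,
      (chainNorm_add_le _ _).trans ?_, ?_⟩
    · simp [chainNorm]
    · rw [Submodule.Quotient.mk_add, mk_single_eq_stepClass]
      rfl
  · refine ⟨z + Finsupp.single ⟨_, isDirectedClique_pair h.1.symm h'⟩ (-1),
      (chainNorm_add_le _ _).trans ?_, ?_⟩
    · simp [chainNorm, -Finsupp.single_neg]
    · rw [Finsupp.single_neg, Submodule.Quotient.mk_add, Submodule.Quotient.mk_neg,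
        mk_single_eq_stepClass, hB.stepClass_symm h.symm]
      rfl

theorem exists_flows_of_ne_zero {z : G.FlagChain 2} (hz : z ≠ 0) : ∃ a b, Flows z a b := by
  obtain ⟨u, hu⟩ := Finsupp.ne_iff.1 hz
  rcases lt_or_gt_of_ne hu with h | h
  · exact ⟨_, _, u, Or.inr ⟨rfl, rfl, h⟩⟩
  · exact ⟨_, _, u, Or.inl ⟨rfl, rfl, h⟩⟩

theorem isDirectedClique_singleton (b : V) : G.IsDirectedClique ![b] :=
  ⟨Function.injective_of_subsingleton _, fun i j h => by omega⟩

open Classical in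
theorem flagBoundary_one_apply (z : G.FlagChain 2) (b : V) :
    G.flagBoundary 1 z ⟨![b], isDirectedClique_singleton b⟩ =
      ∑ u ∈ z.support, z u * ((if u.1 1 = b then 1 else 0) - if u.1 0 = b then 1 else 0) := by
  have key (u : G.DirectedClique 2) (i : Fin 2) (j : Fin 2) (hij : i.succAbove 0 = j) :
      (Finsupp.single (u.face i) (1 : ℤ)) ⟨![b], isDirectedClique_singleton b⟩ =
        if u.1 j = b then 1 else 0 := by
    rw [Finsupp.single_apply]
    refine if_congr ?_ rfl rfl
    rw [Subtype.ext_iff, funext_iff, Fin.forall_fin_one]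
    subst hij
    rfl
  rw [flagBoundary, Finsupp.linearCombination_apply, Finsupp.sum, Finsupp.finsetSum_apply]
  refine Finset.sum_congr rfl fun u _ => ?_
  rw [Finsupp.smul_apply, Fin.sum_univ_two, Finsupp.add_apply, Finsupp.smul_apply,
    Finsupp.smul_apply, key u 0 1 rfl, key u 1 0 rfl]
  rw [smul_eq_mul]
  simp only [Fin.val_zero, Fin.val_one, pow_zero, pow_one, neg_smul, one_smul, sub_eq_add_neg]

/-- Conservation at b: if nothing flowed out of b, every term of the boundary coefficient there
would be nonnegative, and the inflow from a would make the sum positive. -/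
theorem Flows.exists_next {z : G.FlagChain 2} (hz : G.flagBoundary 1 z = 0) {a b : V}
    (h : Flows z a b) : ∃ c, Flows z b c := by
  classical
  by_contra! hc
  have hsum := flagBoundary_one_apply z b
  rw [hz] at hsum
  refine hsum.not_lt (Finset.sum_pos' (fun u _ => ?_) ?_)
  · have hne := u.ne
    have h₁ : u.1 1 = b → 0 ≤ z u := fun h => by
      by_contra! hlt
      exact hc _ ⟨u, Or.inr ⟨rfl, h, hlt⟩⟩
    have h₀ : u.1 0 = b → z u ≤ 0 := fun h => by
      by_contra! hlt
      exact hc _ ⟨u, Or.inl ⟨h, rfl, hlt⟩⟩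
    by_cases h1 : u.1 1 = b
    · have h0 : u.1 0 ≠ b := fun h => hne (h.trans h1.symm)
      simpa [h1, h0] using h₁ h1
    · by_cases h0 : u.1 0 = b
      · simpa [h1, h0] using h₀ h0
      · simp [h1, h0]
  · obtain ⟨u, ⟨h0, h1, hu⟩ | ⟨h0, h1, hu⟩⟩ := h
    · refine ⟨u, Finsupp.mem_support_iff.2 hu.ne', ?_⟩
      have hne := u.ne
      have : u.1 0 ≠ b := by grind
      simp [h1, this, hu]
    · refine ⟨u, Finsupp.mem_support_iff.2 hu.ne, ?_⟩
      have hne := u.ne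
      have : u.1 1 ≠ b := by grind
      simp [h0, this, hu]

/-- Two units of norm are removed and at most one is restored. -/
theorem exists_shorter_of_shortcut (hB : G.DoubleEdgesFilled) (hC : G.CyclicTrianglesFilled)
    {z : G.FlagChain 2} {a b c : V} (hab : Flows z a b) (hbc : Flows z b c)
    (hac : a = c ∨ G.Linked a c) : ∃ z' : G.FlagChain 2, chainNorm z' < chainNorm z ∧
      (Submodule.Quotient.mk z' : G.ChainClass) = Submodule.Quotient.mk z := by
  obtain ⟨z₁, hN₁, hz₁, hf⟩ := hab.exists_sub hB
  obtain ⟨z₂, hN₂, hz₂, -⟩ := (hf b c (Or.inl hab.linked.1.symm) hbc).exists_sub hB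
  rcases hac with rfl | hac
  · refine ⟨z₂, by omega, ?_⟩
    rw [hz₂, hz₁, hB.stepClass_symm hab.linked]
    abel
  · obtain ⟨z₃, hN₃, hz₃⟩ := hac.exists_add hB z₂
    refine ⟨z₃, by omega, ?_⟩
    rw [hz₃, hz₂, hz₁, ← stepClass_triangle hB hC hab.linked hbc.linked hac]
    abel

/-- The path a, b, c, d is homotopic to a, w, d across three triangles with apex w: three units are
removed and at most two restored. -/
theorem exists_shorter_of_centre (hB : G.DoubleEdgesFilled) (hC : G.CyclicTrianglesFilled)
    {z : G.FlagChain 2} {a b c d w : V} (hab : Flows z a b) (hbc : Flows z b c)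
    (hcd : Flows z c d) (hac : a ≠ c) (ha : G.Linked w a) (hb : G.Linked w b)
    (hc : G.Linked w c) (hd : G.Linked w d) :
    ∃ z' : G.FlagChain 2, chainNorm z' < chainNorm z ∧
      (Submodule.Quotient.mk z' : G.ChainClass) = Submodule.Quotient.mk z := by
  obtain ⟨z₁, hN₁, hz₁, hf⟩ := hab.exists_sub hB
  obtain ⟨z₂, hN₂, hz₂, hf'⟩ := (hf b c (Or.inl hab.linked.1.symm) hbc).exists_sub hB
  obtain ⟨z₃, hN₃, hz₃, -⟩ := (hf' c d (Or.inl hbc.linked.1.symm)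
    (hf c d (Or.inl hac.symm) hcd)).exists_sub hB
  obtain ⟨z₄, hN₄, hz₄⟩ := ha.symm.exists_add hB z₃
  obtain ⟨z₅, hN₅, hz₅⟩ := hd.exists_add hB z₄
  refine ⟨z₅, by omega, ?_⟩
  rw [hz₅, hz₄, hz₃, hz₂, hz₁, ← stepClass_triangle hB hC hab.linked hb.symm ha.symm,
    ← stepClass_triangle hB hC hbc.linked hc.symm hb.symm,
    ← stepClass_triangle hB hC hc hcd.linked hd, hB.stepClass_symm hc]
  abel

theorem mk_eq_zero_of_flagBoundary_eq_zero (hA : G.PathsShortened) (hB : G.DoubleEdgesFilled)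
    (hC : G.CyclicTrianglesFilled) (z : G.FlagChain 2) (hz : G.flagBoundary 1 z = 0) :
    (Submodule.Quotient.mk z : G.ChainClass) = 0 := by
  induction hN : chainNorm z using Nat.strong_induction_on generalizing z with
  | _ N ih =>
    subst hN
    by_cases hz0 : z = 0
    · rw [hz0, Submodule.Quotient.mk_zero]
    suffices h : ∃ z' : G.FlagChain 2, chainNorm z' < chainNorm z ∧
        (Submodule.Quotient.mk z' : G.ChainClass) = Submodule.Quotient.mk z by
      obtain ⟨z', hlt, heq⟩ := h
      rw [← heq]
      refine ih _ hlt z' ?_ rfl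
      -- The shorter chain differs from z by a boundary, so it is again a cycle.
      obtain ⟨y, hy⟩ := (Submodule.Quotient.eq _).1 heq
      have := LinearMap.congr_fun (G.flagBoundary_comp_flagBoundary 1) y
      rw [LinearMap.comp_apply, hy, map_sub, hz, sub_zero] at this
      exact this
    obtain ⟨a, b, hab⟩ := exists_flows_of_ne_zero hz0
    obtain ⟨c, hbc⟩ := hab.exists_next hz
    obtain ⟨d, hcd⟩ := hbc.exists_next hz
    by_cases hac : a = c ∨ G.Linked a c
    · exact exists_shorter_of_shortcut hB hC hab hbc hac
    by_cases hbd : b = d ∨ G.Linked b d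
    · exact exists_shorter_of_shortcut hB hC hbc hcd hbd
    rw [not_or] at hac hbd
    -- If a = d, the step from c to d would link c to a, which is excluded.
    have had : a ≠ d := by
      rintro rfl
      exact hac.2 hcd.linked.symm
    have hinj : Function.Injective ![a, b, c, d] := by
      have h₁ := hab.linked.1
      have h₂ := hbc.linked.1
      have h₃ := hcd.linked.1
      have h₄ := hac.1
      have h₅ := hbd.1
      simp only [Fin.cons_injective_iff, Matrix.vecCons, Set.mem_range, Fin.exists_fin_succ]
      simp
      grind [Function.injective_of_subsingleton]
    rcases hA _ hinj hab.linked hbc.linked hcd.linked with h | h | ⟨w, hw⟩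
    · exact (hac.2 h).elim
    · exact (hbd.2 h).elim
    · exact exists_shorter_of_centre hB hC hab hbc hcd hac.1 (hw 0) (hw 1) (hw 2) (hw 3)

theorem flagBetti_one_eq_zero (hA : G.PathsShortened) (hB : G.DoubleEdgesFilled)
    (hC : G.CyclicTrianglesFilled) : G.flagBetti 1 = 0 := by
  have : Subsingleton (G.FlagHomology 1) := by
    refine Submodule.Quotient.subsingleton_iff.2 (eq_top_iff.2 fun z _ => ?_)
    obtain ⟨y, hy⟩ := (Submodule.Quotient.mk_eq_zero _).1
      (mk_eq_zero_of_flagBoundary_eq_zero hA hB hC z.1 z.2)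
    exact ⟨y, Subtype.ext hy⟩
  exact Module.finrank_zero_of_subsingleton

end OneCycles

end Digraph

namespace Digraph

/-! ### Independence of edges -/

section EdgeEvents

variable {n : ℕ} {p : unitInterval}

/-- The event that the edge `e` is present. -/
def edgeEvent {V : Type*} (e : V × V) : Set (Digraph V) := {g | g.Adj e.1 e.2}

/-- The sigma-algebra generated by the edges in `T`. -/
abbrev edgeSigma {V : Type*} (T : Set (V × V)) : MeasurableSpace (Digraph V) :=
  ⨆ e ∈ T, MeasurableSpace.generateFrom {edgeEvent e}

theorem measurableSet_edgeEvent {V : Type*} (e : V × V) : MeasurableSet (edgeEvent e) :=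
  ⟨{r | r e.1 e.2}, measurableSet_setOfPred.2
    ((measurable_pi_apply e.2).comp (measurable_pi_apply e.1)), rfl⟩

theorem generateFrom_edgeEvent_le {V : Type*} (e : V × V) :
    MeasurableSpace.generateFrom {edgeEvent e} ≤ (inferInstance : MeasurableSpace (Digraph V)) :=
  MeasurableSpace.generateFrom_le (by rintro _ rfl; exact measurableSet_edgeEvent e)

theorem edgeSigma_mono {V : Type*} {S T : Set (V × V)} (h : S ⊆ T) : edgeSigma S ≤ edgeSigma T :=
  biSup_mono h

theorem measurableSet_edgeSigma {V : Type*} {T : Set (V × V)} {e : V × V} (he : e ∈ T) :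
    MeasurableSet[edgeSigma T] (edgeEvent e) :=
  le_iSup₂ (f := fun (e : V × V) (_ : e ∈ T) => MeasurableSpace.generateFrom {edgeEvent e}) e he _
    (MeasurableSpace.measurableSet_generateFrom rfl)

/-- The event is a cylinder for the product measure. A loop contributes the factor 0, so loops need
no exclusion. -/
theorem erdosRenyi_biInter_edgeEvent (s : Finset (Fin n × Fin n)) :
    erdosRenyi n p (⋂ e ∈ s, edgeEvent e) =
      ∏ e ∈ s, (unitInterval.toNNReal p • Measure.dirac (e.1 ≠ e.2) +
        unitInterval.toNNReal (unitInterval.symm p) • Measure.dirac False) {True} := by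
  rw [erdosRenyi, Measure.map_apply measurable_ofEdgeSet
    (Finset.measurableSet_biInter s fun e _ => measurableSet_edgeEvent e), setBernoulli_apply']
  refine Eq.trans ?_ (Measure.infinitePi_pi (fun e : Fin n × Fin n => unitInterval.toNNReal p •
      Measure.dirac (e ∈ {e : Fin n × Fin n | e.1 ≠ e.2}) +
        unitInterval.toNNReal (unitInterval.symm p) • Measure.dirac False)
      (t := fun _ => {True}) (fun _ _ => MeasurableSet.of_discrete))
  congr 1
  ext r
  simp [edgeEvent, ofEdgeSet, Set.mem_pi]

theorem iIndepSet_edgeEvent : iIndepSet edgeEvent (erdosRenyi n p) := by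
  refine (iIndepSet_iff_meas_biInter measurableSet_edgeEvent).2 fun s => ?_
  rw [erdosRenyi_biInter_edgeEvent]
  refine Finset.prod_congr rfl fun e _ => ?_
  simpa using (erdosRenyi_biInter_edgeEvent (p := p) {e}).symm

theorem iIndep_edgeEvent :
    iIndep (fun e : Fin n × Fin n => MeasurableSpace.generateFrom {edgeEvent e})
      (erdosRenyi n p) :=
  (iIndepSet_iff_iIndep _ _).1 iIndepSet_edgeEvent

theorem real_edgeEvent {e : Fin n × Fin n} (he : e.1 ≠ e.2) :
    (erdosRenyi n p).real (edgeEvent e) = p := by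
  have h := erdosRenyi_biInter_edgeEvent (p := p) {e}
  rw [Finset.prod_singleton, Finset.set_biInter_singleton] at h
  rw [measureReal_def, h]
  simp [he]

/-- The event that all edges in `S` are present and all edges in `N` are absent. -/
def patternEvent {V : Type*} (S N : Finset (V × V)) : Set (Digraph V) :=
  {g | (∀ e ∈ S, g.Adj e.1 e.2) ∧ ∀ e ∈ N, ¬g.Adj e.1 e.2}

theorem patternEvent_eq {V : Type*} (S N : Finset (V × V)) :
    patternEvent S N = (⋂ e ∈ S, edgeEvent e) ∩ ⋂ e ∈ N, (edgeEvent e)ᶜ := by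
  ext g
  simp [patternEvent, edgeEvent]

theorem measurableSet_patternEvent {V : Type*} {T : Set (V × V)} {S N : Finset (V × V)}
    (hS : ↑S ⊆ T) (hN : ↑N ⊆ T) : MeasurableSet[edgeSigma T] (patternEvent S N) := by
  rw [patternEvent_eq]
  exact MeasurableSet.inter
    (Finset.measurableSet_biInter S fun e he => measurableSet_edgeSigma (hS he))
    (Finset.measurableSet_biInter N fun e he => (measurableSet_edgeSigma (hN he)).compl)

theorem real_patternEvent {S N : Finset (Fin n × Fin n)} (hSN : Disjoint S N)
    (hS : ∀ e ∈ S, e.1 ≠ e.2) (hN : ∀ e ∈ N, e.1 ≠ e.2) :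
    (erdosRenyi n p).real (patternEvent S N) = (p : ℝ) ^ S.card * (1 - (p : ℝ)) ^ N.card := by
  classical
  set f : Fin n × Fin n → Set (Digraph (Fin n)) :=
    fun e => if e ∈ S then edgeEvent e else (edgeEvent e)ᶜ with hf
  have hfS : ∀ e ∈ S, f e = edgeEvent e := fun e he => if_pos he
  have hfN : ∀ e ∈ N, f e = (edgeEvent e)ᶜ := fun e he => if_neg (Finset.disjoint_right.1 hSN he)
  have h := (iIndep_edgeEvent (n := n) (p := p)).meas_biInter (S := S ∪ N) (s := f) fun e _ => by
    have := MeasurableSpace.measurableSet_generateFrom (s := {edgeEvent e}) (t := edgeEvent e) rfl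
    by_cases he : e ∈ S
    · simpa [hf, he] using this
    · simpa [hf, he] using this.compl
  have hset : patternEvent S N = ⋂ e ∈ S ∪ N, f e := by
    rw [Finset.set_biInter_inter, patternEvent_eq]
    congr 1
    · exact Set.iInter₂_congr fun e he => (hfS e he).symm
    · exact Set.iInter₂_congr fun e he => (hfN e he).symm
  rw [measureReal_def, hset, h, ENNReal.toReal_prod, Finset.prod_union hSN]
  congr 1
  · refine Finset.prod_eq_pow_card fun e he => ?_
    rw [hfS e he]
    exact real_edgeEvent (hS e he)
  · refine Finset.prod_eq_pow_card fun e he => ?_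
    rw [hfN e he, ← measureReal_def, probReal_compl_eq_one_sub (measurableSet_edgeEvent e),
      real_edgeEvent (hN e he)]

/-- Used with K describing a fixed small configuration and one `D j` for each outer vertex or star.
-/
theorem real_inter_biInter {ι : Type*} {K : Set (Digraph (Fin n))} {T₀ : Set (Fin n × Fin n)}
    {D : ι → Set (Digraph (Fin n))} {T : ι → Set (Fin n × Fin n)} {J : Finset ι}
    (hK : MeasurableSet[edgeSigma T₀] K) (hD : ∀ j ∈ J, MeasurableSet[edgeSigma (T j)] (D j))
    (h₀ : ∀ j ∈ J, Disjoint T₀ (T j)) (hT : (J : Set ι).PairwiseDisjoint T) :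
    (erdosRenyi n p).real (K ∩ ⋂ j ∈ J, D j) =
      (erdosRenyi n p).real K * ∏ j ∈ J, (erdosRenyi n p).real (D j) := by
  classical
  induction J using Finset.induction_on with
  | empty => simp
  | insert a J ha ih =>
    have hJ : ↑J ⊆ (↑(insert a J) : Set ι) := by simp
    have ih := ih (fun j hj => hD j (hJ hj)) (fun j hj => h₀ j (hJ hj)) (hT.subset hJ)
    have hdisj : Disjoint (T₀ ∪ ⋃ j ∈ J, T j) (T a) := by
      refine Set.disjoint_union_left.2 ⟨h₀ a (by simp), ?_⟩
      refine Set.disjoint_iUnion₂_left.2 fun j hj => hT (hJ hj) (by simp) ?_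
      rintro rfl
      exact ha hj
    have hind := indep_iSup_of_disjoint generateFrom_edgeEvent_le
      (iIndep_edgeEvent (n := n) (p := p)) hdisj
    have hm : MeasurableSet[edgeSigma (T₀ ∪ ⋃ j ∈ J, T j)] (K ∩ ⋂ j ∈ J, D j) := by
      refine MeasurableSet.inter (edgeSigma_mono Set.subset_union_left _ hK)
        (Finset.measurableSet_biInter J fun j hj => ?_)
      exact edgeSigma_mono ((Set.subset_biUnion_of_mem (u := fun j => T j) hj).trans
        Set.subset_union_right) _ (hD j (hJ hj))
    have hmul := (Indep_iff _ _ _).1 hind _ _ hm (hD a (by simp))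
    rw [Finset.set_biInter_insert, Set.inter_comm (D a), ← Set.inter_assoc, measureReal_def, hmul,
      ENNReal.toReal_mul, ← measureReal_def, ← measureReal_def, ih, Finset.prod_insert ha]
    ring

instance : DiscreteMeasurableSpace (Digraph (Fin n)) := by
  refine ⟨fun s => ⟨Digraph.Adj '' s, .of_discrete, ?_⟩⟩
  exact Set.preimage_image_eq s fun g h hgh => Digraph.ext hgh

end EdgeEvents

/-! ### Unfilled double edges and directed 3-cycles -/

section UnfilledEvent

variable {n : ℕ} {p : unitInterval}

/-- All edges in `S` are present, and outside of `s` there is neither a common in-neighbour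
nor a common out-neighbour of `s`. -/
def unfilledEvent {V : Type*} (S : Finset (V × V)) (s : Finset V) : Set (Digraph V) :=
  {g | (∀ e ∈ S, g.Adj e.1 e.2) ∧
    ∀ w, w ∉ s → ¬(∀ x ∈ s, g.Adj w x) ∧ ¬∀ x ∈ s, g.Adj x w}

/-- The edges from `w` to `s`, or those from `s` to `w`. -/
def star {V : Type*} (s : Finset V) : V × Bool → Finset (V × V)
  | (w, true) => s.map (Function.Embedding.sectR w V)
  | (w, false) => s.map (Function.Embedding.sectL V w)

theorem mem_star_true {V : Type*} {s : Finset V} {w : V} {e : V × V} :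
    e ∈ star s (w, true) ↔ e.1 = w ∧ e.2 ∈ s := by
  obtain ⟨a, b⟩ := e
  simp [star]
  tauto

theorem mem_star_false {V : Type*} {s : Finset V} {w : V} {e : V × V} :
    e ∈ star s (w, false) ↔ e.1 ∈ s ∧ e.2 = w := by
  obtain ⟨a, b⟩ := e
  simp [star]
  tauto

theorem card_star {V : Type*} (s : Finset V) (j : V × Bool) : (star s j).card = s.card := by
  obtain ⟨w, b⟩ := j
  cases b <;> exact Finset.card_map _

/-- Each outer vertex contributes one condition per direction, whence the exponent 2(n − |s|). -/
theorem unfilledEvent_eq (S : Finset (Fin n × Fin n)) (s : Finset (Fin n)) :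
    unfilledEvent S s = patternEvent S ∅ ∩
      ⋂ j ∈ sᶜ ×ˢ (Finset.univ : Finset Bool), (patternEvent (star s j) ∅)ᶜ := by
  ext g
  simp only [unfilledEvent, patternEvent, Set.mem_ofPred_eq, Set.mem_inter_iff, Set.mem_iInter,
    Set.mem_compl_iff, Finset.notMem_empty, false_imp_iff, implies_true, and_true, Prod.forall,
    Finset.mem_product, Finset.mem_compl, Finset.mem_univ, Bool.forall_bool, mem_star_true,
    mem_star_false]
  refine and_congr_right fun _ => forall_congr' fun w => ?_
  grind

theorem real_unfilledEvent {S : Finset (Fin n × Fin n)} {s : Finset (Fin n)}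
    (hS : S ⊆ s.offDiag) :
    (erdosRenyi n p).real (unfilledEvent S s) =
      (p : ℝ) ^ S.card * (1 - (p : ℝ) ^ s.card) ^ (2 * (n - s.card)) := by
  have hS' : ∀ e ∈ S, e.1 ∈ s ∧ e.2 ∈ s ∧ e.1 ≠ e.2 := fun e he => Finset.mem_offDiag.1 (hS he)
  rw [unfilledEvent_eq, real_inter_biInter (T₀ := S) (T := fun j => star s j)]
  · rw [real_patternEvent (by simp) (fun e he => (hS' e he).2.2) (by simp), Finset.card_empty,
      pow_zero, mul_one]
    congr 1
    rw [Finset.prod_eq_pow_card (b := 1 - (p : ℝ) ^ s.card)]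
    · rw [Finset.card_product, Finset.card_compl, Fintype.card_fin, Finset.card_univ,
        Fintype.card_bool, mul_comm]
    · rintro ⟨w, b⟩ hj
      have hw : w ∉ s := by simpa using hj
      rw [probReal_compl_eq_one_sub .of_discrete, real_patternEvent (by simp) _ (by simp)]
      · simp [card_star]
      · cases b <;> simp only [mem_star_true, mem_star_false] <;> grind
  · exact measurableSet_patternEvent subset_rfl (by simp)
  · exact fun j _ => (measurableSet_patternEvent subset_rfl (by simp)).compl
  · rintro ⟨w, b⟩ hj
    have hw : w ∉ s := by simpa using hj
    rw [Finset.disjoint_coe, Finset.disjoint_left]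
    cases b <;> simp only [mem_star_true, mem_star_false] <;> grind
  · rintro ⟨w, b⟩ hj ⟨w', b'⟩ hj' hne
    have hw : w ∉ s := by simpa using hj
    have hw' : w' ∉ s := by simpa using hj'
    simp only [Function.onFun]
    rw [Finset.disjoint_coe, Finset.disjoint_left]
    cases b <;> cases b' <;> simp only [mem_star_true, mem_star_false] <;> grind

theorem exists_unfilledEvent_of_not_doubleEdgesFilled {g : Digraph (Fin n)}
    (h : ¬g.DoubleEdgesFilled) :
    ∃ s ∈ Finset.powersetCard 2 (Finset.univ : Finset (Fin n)),
      g ∈ unfilledEvent s.offDiag s := by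
  simp only [DoubleEdgesFilled, not_forall, not_exists] at h
  obtain ⟨a, b, hab, h₁, h₂, hw⟩ := h
  refine ⟨{a, b}, by simp [Finset.mem_powersetCard, hab], ?_, fun w hws => ?_⟩
  · rintro ⟨x, y⟩ hxy
    simp at hxy
    grind
  · have := hw w
    simp at hws ⊢
    tauto

/-- Some directed cycle through the vertices of `s` has neither a common in-neighbour nor a common
out-neighbour. -/
def unfilledCycleEvent (s : Finset (Fin n)) : Set (Digraph (Fin n)) :=
  {g | ∃ a b c, a ≠ b ∧ a ≠ c ∧ b ≠ c ∧ s = {a, b, c} ∧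
    g ∈ unfilledEvent {(a, b), (b, c), (c, a)} s}

/-- Three vertices carry exactly two cyclic orders, whence the factor 2. -/
theorem real_unfilledCycleEvent_le {s : Finset (Fin n)} (hs : s.card = 3) :
    (erdosRenyi n p).real (unfilledCycleEvent s) ≤
      2 * ((p : ℝ) ^ 3 * (1 - (p : ℝ) ^ 3) ^ (2 * (n - 3))) := by
  obtain ⟨a, b, c, hab, hac, hbc, rfl⟩ := Finset.card_eq_three.1 hs
  have hsub : unfilledCycleEvent {a, b, c} ⊆
      unfilledEvent {(a, b), (b, c), (c, a)} {a, b, c} ∪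
        unfilledEvent {(a, c), (c, b), (b, a)} {a, b, c} := by
    rintro g ⟨x, y, z, hxy, hxz, hyz, hs, hS, hw⟩
    have hx : x = a ∨ x = b ∨ x = c := by
      have : x ∈ ({a, b, c} : Finset (Fin n)) := by rw [hs]; simp
      simpa using this
    have hy : y = a ∨ y = b ∨ y = c := by
      have : y ∈ ({a, b, c} : Finset (Fin n)) := by rw [hs]; simp
      simpa using this
    have hz : z = a ∨ z = b ∨ z = c := by
      have : z ∈ ({a, b, c} : Finset (Fin n)) := by rw [hs]; simp
      simpa using this
    suffices (∀ e ∈ ({(a, b), (b, c), (c, a)} : Finset (Fin n × Fin n)), g.Adj e.1 e.2) ∨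
        ∀ e ∈ ({(a, c), (c, b), (b, a)} : Finset (Fin n × Fin n)), g.Adj e.1 e.2 from
      this.imp (fun h => ⟨h, hw⟩) fun h => ⟨h, hw⟩
    simp only [Finset.mem_insert, Finset.mem_singleton, forall_eq_or_imp, forall_eq] at hS ⊢
    clear hs hw
    rcases hx with rfl | rfl | rfl <;> rcases hy with rfl | rfl | rfl <;>
      rcases hz with rfl | rfl | rfl <;> tauto
  have hval (S : Finset (Fin n × Fin n)) (hS : S ⊆ ({a, b, c} : Finset (Fin n)).offDiag)
      (hc : S.card = 3) : (erdosRenyi n p).real (unfilledEvent S {a, b, c}) =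
        (p : ℝ) ^ 3 * (1 - (p : ℝ) ^ 3) ^ (2 * (n - 3)) := by
    rw [real_unfilledEvent hS, hc, hs]
  refine (measureReal_mono hsub).trans ((measureReal_union_le _ _).trans_eq ?_)
  rw [hval _ ?_ ?_, hval _ ?_ ?_, ← two_mul]
  · intro e
    simp only [Finset.mem_insert, Finset.mem_singleton, Finset.mem_offDiag]
    grind
  · exact Finset.card_eq_three.2 ⟨_, _, _, by grind, by grind, by grind, rfl⟩
  · intro e
    simp only [Finset.mem_insert, Finset.mem_singleton, Finset.mem_offDiag]
    grind
  · exact Finset.card_eq_three.2 ⟨_, _, _, by grind, by grind, by grind, rfl⟩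

theorem exists_unfilledCycleEvent_of_not_cyclicTrianglesFilled {g : Digraph (Fin n)}
    (h : ¬g.CyclicTrianglesFilled) :
    ∃ s ∈ Finset.powersetCard 3 (Finset.univ : Finset (Fin n)), g ∈ unfilledCycleEvent s := by
  simp only [CyclicTrianglesFilled, not_forall, not_exists] at h
  obtain ⟨a, b, c, hab, hac, hbc, h₁, h₂, h₃, hw⟩ := h
  refine ⟨{a, b, c}, ?_, a, b, c, hab, hac, hbc, rfl, ?_, fun w hws => ?_⟩
  · rw [Finset.mem_powersetCard_univ, Finset.card_eq_three]
    exact ⟨a, b, c, hab, hac, hbc, rfl⟩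
  · simp [h₁, h₂, h₃]
  · have := hw w
    simp at hws ⊢
    tauto

end UnfilledEvent

end Digraph

namespace Digraph

/-! ### Paths of length 3 without shortcut or centre -/

section PathEvent

variable {n : ℕ} {p : unitInterval}

/-- The edges of a path of length 3, for the four orientations up to reversal. -/
def pathEdges : Fin 4 → Finset (Fin 4 × Fin 4) :=
  ![{(0, 1), (1, 2), (2, 3)}, {(0, 1), (1, 2), (3, 2)}, {(1, 0), (1, 2), (2, 3)},
    {(0, 1), (2, 1), (2, 3)}]

/-- The edges between the vertices at distance 2 of a path of length 3 that complete two of its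
edges to a transitive triangle. -/
def shortcutEdges : Fin 4 → Finset (Fin 4 × Fin 4) :=
  ![{(0, 2), (1, 3)}, {(0, 2), (1, 3), (3, 1)}, {(0, 2), (2, 0), (1, 3)},
    {(0, 2), (2, 0), (1, 3), (3, 1)}]

theorem card_pathEdges (m : Fin 4) : (pathEdges m).card = 3 := by decide +revert

theorem card_shortcutEdges (m : Fin 4) : (shortcutEdges m).card = shortcutCount m := by
  decide +revert

theorem disjoint_pathEdges_shortcutEdges (m : Fin 4) :
    Disjoint (pathEdges m) (shortcutEdges m) := by decide +revert

theorem ne_of_mem_pathEdges : ∀ m, ∀ e ∈ pathEdges m, e.1 ≠ e.2 := by decide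

theorem ne_of_mem_shortcutEdges : ∀ m, ∀ e ∈ shortcutEdges m, e.1 ≠ e.2 := by decide

/-- The event that `w` is joined to all of the vertices `v i`. -/
def centreEvent (v : Fin 4 ↪ Fin n) (w : Fin n) : Set (Digraph (Fin n)) :=
  {g | ∀ i, g.Adj w (v i) ∨ g.Adj (v i) w}

/-- The vertices `v i` span a path in the orientation class `m` that has neither a shortcut nor a
vertex joined to all of its vertices. -/
def pathEvent (m : Fin 4) (v : Fin 4 ↪ Fin n) : Set (Digraph (Fin n)) :=
  patternEvent ((pathEdges m).map (v.prodMap v)) ((shortcutEdges m).map (v.prodMap v)) ∩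
    ⋂ w ∈ (Finset.univ.map v)ᶜ, (centreEvent v w)ᶜ

/-- The two possible edges between `a` and `b`. -/
def bothEdges (a b : Fin n) : Finset (Fin n × Fin n) := {(a, b), (b, a)}

theorem mem_bothEdges {a b : Fin n} {e : Fin n × Fin n} :
    e ∈ bothEdges a b ↔ (e.1 = a ∧ e.2 = b) ∨ (e.1 = b ∧ e.2 = a) := by
  simp [bothEdges, Prod.ext_iff]

theorem centreEvent_eq (v : Fin 4 ↪ Fin n) (w : Fin n) :
    centreEvent v w = Set.univ ∩ ⋂ i ∈ (Finset.univ : Finset (Fin 4)),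
      (patternEvent ∅ (bothEdges w (v i)))ᶜ := by
  ext g
  simp only [centreEvent, patternEvent, Set.mem_ofPred_eq, Set.univ_inter, Set.mem_iInter,
    Set.mem_compl_iff, Finset.notMem_empty, false_imp_iff, implies_true, true_and, Finset.mem_univ,
    bothEdges, Finset.mem_insert, Finset.mem_singleton, forall_eq_or_imp, forall_eq]
  grind

theorem measurableSet_centreEvent (v : Fin 4 ↪ Fin n) (w : Fin n) :
    MeasurableSet[edgeSigma (⋃ i, ↑(bothEdges w (v i)))] (centreEvent v w) := by
  rw [centreEvent_eq]
  exact MeasurableSet.univ.inter (Finset.measurableSet_biInter _ fun i _ =>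
    (measurableSet_patternEvent (by simp)
      (Set.subset_iUnion (fun i => (bothEdges w (v i) : Set (Fin n × Fin n))) i)).compl)

/-- The four pairs {w, v i} are independent, and each is unlinked with probability (1 − p)². -/
theorem real_centreEvent {v : Fin 4 ↪ Fin n} {w : Fin n} (hw : ∀ i, w ≠ v i) :
    (erdosRenyi n p).real (centreEvent v w) = (1 - (1 - (p : ℝ)) ^ 2) ^ 4 := by
  rw [centreEvent_eq, real_inter_biInter (T₀ := ∅) (T := fun i => bothEdges w (v i))]
  · rw [probReal_univ, one_mul, Finset.prod_eq_pow_card (b := 1 - (1 - (p : ℝ)) ^ 2)]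
    · simp
    · intro i _
      rw [probReal_compl_eq_one_sub .of_discrete, real_patternEvent (by simp) (by simp), bothEdges,
        Finset.card_pair]
      · simp
      · simp [hw i]
      · intro e he
        have := hw i
        have := mem_bothEdges.1 he
        grind
  · exact MeasurableSet.univ
  · exact fun i _ => (measurableSet_patternEvent (by simp) subset_rfl).compl
  · simp
  · intro i _ j _ hij
    have := hw i
    have := hw j
    have := v.injective.ne hij
    simp only [Function.onFun]
    rw [Finset.disjoint_coe, Finset.disjoint_left]
    simp only [mem_bothEdges]
    grind

theorem real_pathEvent (m : Fin 4) (v : Fin 4 ↪ Fin n) :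
    (erdosRenyi n p).real (pathEvent m v) = (p : ℝ) ^ 3 * (1 - (p : ℝ)) ^ shortcutCount m *
      (1 - (1 - (1 - (p : ℝ)) ^ 2) ^ 4) ^ (n - 4) := by
  have hne (S : Finset (Fin 4 × Fin 4)) (hS : ∀ e ∈ S, e.1 ≠ e.2) :
      ∀ e ∈ S.map (v.prodMap v), e.1 ≠ e.2 := by
    intro e he
    obtain ⟨e, he', rfl⟩ := Finset.mem_map.1 he
    exact v.injective.ne (hS e he')
  have hmem {w : Fin n} (hw : w ∈ (Finset.univ.map v)ᶜ) (i : Fin 4) : w ≠ v i := by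
    rintro rfl
    simp at hw
  rw [pathEvent, real_inter_biInter
    (T₀ := ↑((pathEdges m ∪ shortcutEdges m).map (v.prodMap v)))
    (T := fun w => ⋃ i, ↑(bothEdges w (v i)))]
  · rw [real_patternEvent ((Finset.disjoint_map _).2 (disjoint_pathEdges_shortcutEdges m))
      (hne _ (ne_of_mem_pathEdges m)) (hne _ (ne_of_mem_shortcutEdges m)), Finset.card_map,
      Finset.card_map, card_pathEdges, card_shortcutEdges,
      Finset.prod_eq_pow_card (b := 1 - (1 - (1 - (p : ℝ)) ^ 2) ^ 4)]
    · rw [Finset.card_compl, Finset.card_map, Finset.card_univ, Fintype.card_fin, Fintype.card_fin]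
    · intro w hw
      rw [probReal_compl_eq_one_sub .of_discrete, real_centreEvent (hmem hw)]
  · refine measurableSet_patternEvent ?_ ?_ <;> rw [Finset.coe_subset, Finset.map_subset_map]
    · exact Finset.subset_union_left
    · exact Finset.subset_union_right
  · exact fun w _ => (measurableSet_centreEvent v w).compl
  · intro w hw
    have hw := hmem hw
    refine Set.disjoint_iUnion_right.2 fun i => ?_
    rw [Finset.disjoint_coe, Finset.disjoint_left]
    intro e he
    obtain ⟨e, he', rfl⟩ := Finset.mem_map.1 he
    rw [mem_bothEdges]
    have h₁ := hw e.1
    have h₂ := hw e.2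
    rintro (⟨h, -⟩ | ⟨-, h⟩)
    · exact h₁ h.symm
    · exact h₂ h.symm
  · intro w hw w' hw' hne
    have hw := hmem hw
    have hw' := hmem hw'
    simp only [Function.onFun, Set.disjoint_iUnion_left, Set.disjoint_iUnion_right]
    intro i j
    have := hw i
    have := hw j
    have := hw' i
    have := hw' j
    rw [Finset.disjoint_coe, Finset.disjoint_left]
    simp only [mem_bothEdges]
    grind

/-- All four edges between vertices at distance 2 are absent, but only those in `shortcutEdges m`
are recorded. This enlarges the event and yields the exponent `shortcutCount m`. -/
theorem mem_pathEvent {g : Digraph (Fin n)} {m : Fin 4} {v : Fin 4 ↪ Fin n}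
    (h : ∀ e ∈ pathEdges m, g.Adj (v e.1) (v e.2)) (h₀₂ : ¬g.Linked (v 0) (v 2))
    (h₁₃ : ¬g.Linked (v 1) (v 3)) (hw : ∀ w, ∃ i, ¬g.Linked w (v i)) : g ∈ pathEvent m v := by
  have hns : ∀ e ∈ shortcutEdges m,
      e = (0, 2) ∨ e = (2, 0) ∨ e = (1, 3) ∨ e = (3, 1) := by
    clear h
    decide +revert
  have n₀₂ : v 0 ≠ v 2 := v.injective.ne (by decide)
  have n₁₃ : v 1 ≠ v 3 := v.injective.ne (by decide)
  simp only [Linked, not_and, not_or] at h₀₂ h₁₃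
  refine ⟨⟨?_, ?_⟩, ?_⟩
  · intro e he
    obtain ⟨e, he', rfl⟩ := Finset.mem_map.1 he
    exact h e he'
  · intro e he
    obtain ⟨e, he', rfl⟩ := Finset.mem_map.1 he
    rcases hns e he' with rfl | rfl | rfl | rfl
    · exact (h₀₂ n₀₂).1
    · exact (h₀₂ n₀₂).2
    · exact (h₁₃ n₁₃).1
    · exact (h₁₃ n₁₃).2
  · refine Set.mem_iInter₂.2 fun w hwv hc => ?_
    obtain ⟨i, hi⟩ := hw w
    refine hi ⟨?_, hc i⟩
    rintro rfl
    simp at hwv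

/-- The eight orientations form four classes up to reversal. Reversing the path interchanges the two
shortcut pairs. -/
theorem exists_pathEvent_of_not_pathsShortened {g : Digraph (Fin n)} (h : ¬g.PathsShortened) :
    ∃ m v, g ∈ pathEvent m v := by
  simp only [PathsShortened, not_forall, not_or, not_exists] at h
  obtain ⟨v, hv, h₀₁, h₁₂, h₂₃, h₀₂, h₁₃, hw⟩ := h
  have forward (m : Fin 4) (h : ∀ e ∈ pathEdges m, g.Adj (v e.1) (v e.2)) :
      ∃ m v, g ∈ pathEvent m v :=
    ⟨m, ⟨v, hv⟩, mem_pathEvent h h₀₂ h₁₃ hw⟩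
  have backward (m : Fin 4) (h : ∀ e ∈ pathEdges m, g.Adj (v e.1.rev) (v e.2.rev)) :
      ∃ m v, g ∈ pathEvent m v := by
    refine ⟨m, ⟨v ∘ Fin.rev, hv.comp Fin.rev_injective⟩, mem_pathEvent h ?_ ?_ fun w => ?_⟩
    · exact fun h => h₁₃ h.symm
    · exact fun h => h₀₂ h.symm
    · obtain ⟨i, hi⟩ := hw w
      exact ⟨i.rev, by simpa using hi⟩
  have r₀ : (0 : Fin 4).rev = 3 := rfl
  have r₁ : (1 : Fin 4).rev = 2 := rfl
  have r₂ : (2 : Fin 4).rev = 1 := rfl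
  have r₃ : (3 : Fin 4).rev = 0 := rfl
  rcases h₀₁.2 with a | a <;> rcases h₁₂.2 with b | b <;> rcases h₂₃.2 with c | c
  · exact forward 0 (by simp [pathEdges, a, b, c])
  · exact forward 1 (by simp [pathEdges, a, b, c])
  · exact forward 3 (by simp [pathEdges, a, b, c])
  · exact backward 1 (by simp [pathEdges, r₀, r₁, r₂, r₃, a, b, c])
  · exact forward 2 (by simp [pathEdges, a, b, c])
  · exact backward 3 (by simp [pathEdges, r₀, r₁, r₂, r₃, a, b, c])
  · exact backward 2 (by simp [pathEdges, r₀, r₁, r₂, r₃, a, b, c])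
  · exact backward 0 (by simp [pathEdges, r₀, r₁, r₂, r₃, a, b, c])

end PathEvent

/-- With q = 1 − p one has 1 − q² = p(p + 2q). Its fourth power has coefficients 16, 32, 24, 8, 1 at
p⁴q⁴, …, p⁸, and these dominate every row of Q. -/
theorem sum_centreCount_le (p : unitInterval) (m : Fin 4) :
    ∑ l : Fin 9, (centreCount m l : ℝ) * (p : ℝ) ^ (l : ℕ) * (1 - (p : ℝ)) ^ (8 - (l : ℕ)) ≤
      (1 - (1 - (p : ℝ)) ^ 2) ^ 4 := by
  have hp : (0 : ℝ) ≤ p := p.2.1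
  have hq : (0 : ℝ) ≤ 1 - (p : ℝ) := sub_nonneg.2 p.2.2
  -- An opaque q keeps the monomials in p and q from being expanded, so the comparison is linear in
  -- them.
  obtain ⟨q, hpq⟩ : ∃ q : ℝ, q = 1 - (p : ℝ) := ⟨_, rfl⟩
  rw [← hpq] at hq ⊢
  have hexp : (1 - q ^ 2) ^ 4 = 16 * ((p : ℝ) ^ 4 * q ^ 4) + 32 * ((p : ℝ) ^ 5 * q ^ 3) +
      24 * ((p : ℝ) ^ 6 * q ^ 2) + 8 * ((p : ℝ) ^ 7 * q) + (p : ℝ) ^ 8 := by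
    rw [hpq]
    ring
  have h₄ : 0 ≤ (p : ℝ) ^ 4 * q ^ 4 := by positivity
  have h₅ : 0 ≤ (p : ℝ) ^ 5 * q ^ 3 := by positivity
  have h₆ : 0 ≤ (p : ℝ) ^ 6 * q ^ 2 := by positivity
  rw [hexp]
  fin_cases m <;> simp [centreCount, Fin.sum_univ_succ] <;> linarith

theorem real_pathEvent_le {n : ℕ} {p : unitInterval} (m : Fin 4) (v : Fin 4 ↪ Fin n) :
    (erdosRenyi n p).real (pathEvent m v) ≤ (p : ℝ) ^ 3 * (1 - (p : ℝ)) ^ shortcutCount m *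
      (1 - ∑ l : Fin 9, (centreCount m l : ℝ) * (p : ℝ) ^ (l : ℕ) *
        (1 - (p : ℝ)) ^ (8 - (l : ℕ))) ^ (n - 4) := by
  have hp : (0 : ℝ) ≤ p := p.2.1
  have hq : (0 : ℝ) ≤ 1 - (p : ℝ) := sub_nonneg.2 p.2.2
  have hq' : 1 - (p : ℝ) ≤ 1 := by linarith
  rw [real_pathEvent]
  refine mul_le_mul_of_nonneg_left (pow_le_pow_left₀ ?_ ?_ _) (by positivity)
  · have h₁ : (1 - (p : ℝ)) ^ 2 ≤ 1 := pow_le_one₀ hq hq'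
    have h₂ : 0 ≤ (1 - (p : ℝ)) ^ 2 := by positivity
    exact sub_nonneg.2 (pow_le_one₀ (by linarith) (by linarith))
  · exact sub_le_sub_left (sum_centreCount_le p m) 1

/-! ### Union bound -/

/-- The union of the events that obstruct the vanishing of the first homology group. -/
def obstruction (n : ℕ) : Set (Digraph (Fin n)) :=
  ((⋃ m ∈ (Finset.univ : Finset (Fin 4)), ⋃ v ∈ (Finset.univ : Finset (Fin 4 ↪ Fin n)),
      pathEvent m v) ∪
    ⋃ s ∈ Finset.powersetCard 2 (Finset.univ : Finset (Fin n)), unfilledEvent s.offDiag s) ∪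
    ⋃ s ∈ Finset.powersetCard 3 (Finset.univ : Finset (Fin n)), unfilledCycleEvent s

theorem mem_obstruction {n : ℕ} {g : Digraph (Fin n)} (hg : 0 < g.flagBetti 1) :
    g ∈ obstruction n := by
  by_contra h
  simp only [obstruction, Set.mem_union, Set.mem_iUnion, not_or, Finset.mem_univ,
    exists_prop, true_and] at h
  refine hg.ne' (flagBetti_one_eq_zero ?_ ?_ ?_)
  · by_contra hA
    exact h.1.1 (exists_pathEvent_of_not_pathsShortened hA)
  · by_contra hB
    exact h.1.2 (exists_unfilledEvent_of_not_doubleEdgesFilled hB)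
  · by_contra hC
    exact h.2 (exists_unfilledCycleEvent_of_not_cyclicTrianglesFilled hC)

theorem real_obstruction_le (n : ℕ) (p : unitInterval) :
    (erdosRenyi n p).real (obstruction n) ≤
      (n.choose 4 : ℝ) * (Nat.factorial 4 : ℝ) *
          ∑ m : Fin 4, (p : ℝ) ^ 3 * (1 - (p : ℝ)) ^ shortcutCount m *
            (1 - ∑ l : Fin 9, (centreCount m l : ℝ) * (p : ℝ) ^ (l : ℕ) *
              (1 - (p : ℝ)) ^ (8 - (l : ℕ))) ^ (n - 4)
        + (n.choose 2 : ℝ) * (p : ℝ) ^ 2 * (1 - (p : ℝ) ^ 2) ^ (2 * n - 4)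
        + 2 * (n.choose 3 : ℝ) * (p : ℝ) ^ 3 * (1 - (p : ℝ) ^ 3) ^ (2 * n - 6) := by
  refine (measureReal_union_le _ _).trans (add_le_add ((measureReal_union_le _ _).trans
    (add_le_add ?_ ?_)) ?_)
  · refine (measureReal_biUnion_finset_le _ _).trans ?_
    rw [Finset.mul_sum]
    refine Finset.sum_le_sum fun m _ => (measureReal_biUnion_finset_le _ _).trans ?_
    refine (Finset.sum_le_card_nsmul _ _ _ fun v _ => real_pathEvent_le m v).trans_eq ?_
    rw [Finset.card_univ, Fintype.card_embedding_eq, Fintype.card_fin, Fintype.card_fin,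
      Nat.descFactorial_eq_factorial_mul_choose, nsmul_eq_mul, Nat.cast_mul,
      mul_comm (n.choose 4 : ℝ)]
  · refine (measureReal_biUnion_finset_le _ _).trans ?_
    refine (Finset.sum_le_card_nsmul _ _ ((p : ℝ) ^ 2 * (1 - (p : ℝ) ^ 2) ^ (2 * n - 4))
      fun s hs => ?_).trans_eq ?_
    · have hs := (Finset.mem_powersetCard.1 hs).2
      rw [real_unfilledEvent subset_rfl, Finset.offDiag_card, hs, Nat.mul_sub]
    · rw [Finset.card_powersetCard, Finset.card_univ, Fintype.card_fin, nsmul_eq_mul, mul_assoc]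
  · refine (measureReal_biUnion_finset_le _ _).trans ?_
    refine (Finset.sum_le_card_nsmul _ _ (2 * ((p : ℝ) ^ 3 * (1 - (p : ℝ) ^ 3) ^ (2 * n - 6)))
      fun s hs => ?_).trans_eq ?_
    · refine (real_unfilledCycleEvent_le (Finset.mem_powersetCard.1 hs).2).trans_eq ?_
      rw [Nat.mul_sub]
    · rw [Finset.card_powersetCard, Finset.card_univ, Fintype.card_fin, nsmul_eq_mul]
      ring

end Digraph

theorem mainTheorem7 {Ω : Type*} [MeasurableSpace Ω] (P : Measure Ω) (n : ℕ) (p : unitInterval)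
    (G : Ω → Digraph (Fin n)) (hG : HasLaw G (Digraph.erdosRenyi n p) P) :
    P.real {ω | 0 < (G ω).flagBetti 1} ≤
      (n.choose 4 : ℝ) * (Nat.factorial 4 : ℝ) *
          ∑ m : Fin 4, (p : ℝ) ^ 3 * (1 - (p : ℝ)) ^ shortcutCount m *
            (1 - ∑ l : Fin 9, (centreCount m l : ℝ) * (p : ℝ) ^ (l : ℕ) *
              (1 - (p : ℝ)) ^ (8 - (l : ℕ))) ^ (n - 4)
        + (n.choose 2 : ℝ) * (p : ℝ) ^ 2 * (1 - (p : ℝ) ^ 2) ^ (2 * n - 4)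
        + 2 * (n.choose 3 : ℝ) * (p : ℝ) ^ 3 * (1 - (p : ℝ) ^ 3) ^ (2 * n - 6) := by
  -- Since G is only almost everywhere measurable, the Betti event is handled by monotonicity alone,
  -- which needs P finite but no measurability.
  have : IsProbabilityMeasure P := hG.isProbabilityMeasure
  have hlaw : P.real (G ⁻¹' Digraph.obstruction n) =
      (Digraph.erdosRenyi n p).real (Digraph.obstruction n) := by
    rw [measureReal_def, measureReal_def, ← hG.map_eq,
      Measure.map_apply_of_aemeasurable hG.aemeasurable .of_discrete]
  calc P.real {ω | 0 < (G ω).flagBetti 1}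
      ≤ P.real (G ⁻¹' Digraph.obstruction n) :=
        measureReal_mono fun ω hω => Digraph.mem_obstruction hω
    _ ≤ _ := hlaw.trans_le (Digraph.real_obstruction_le n p)
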